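/- Let $(K,+,\cdot)$ be a semifield: $(K,\cdot)$ is a commutative group, $+$ is associative and commutative, and $\cdot$ distributes over $+$ (there is no zero and no subtraction). Let $P$ be a polygon, that is, a finite set of at least three vertices with a cyclic order. A diagonal of $P$ is a set of two distinct vertices; the set of diagonals is $\operatorname{diag}(P)$. A diagonal is internal if its end points are not neighbours in the cyclic order. Diagonals $\{\alpha,\beta\}$ and $\{\gamma,\delta\}$ cross if $\alpha,\beta,\gamma,\delta$ are four distinct vertices appearing in the cyclic order $\alpha,\gamma,\beta,\delta$ or $\alpha,\delta,\beta,\gamma$. Let $D$ be a dissection of $P$, that is, a (possibly empty) set of pairwise non-crossing internal diagonals. Let $f:\operatorname{diag}(P)\to K$ be a map and write $f(\alpha,\beta)=f(\{\alpha,\beta\})$. The map $f$ is a weak frieze with respect to $D$ if $$f(\alpha,\beta)f(\gamma,\delta)=f(\alpha,\gamma)f(\beta,\delta)+f(\alpha,\delta)f(\beta,\gamma)$$ whenever $\{\alpha,\beta\}$ and $\{\gamma,\delta\}$ are crossing diagonals with $\{\gamma,\delta\}\in D$. For vertices $\alpha\neq\beta$, a $T$-path from $\alpha$ to $\beta$ with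 respect to $D$ is a tuple $\pi=(\pi_1,\dots,\pi_p)$ of vertices with $\pi_1=\alpha$, $\pi_p=\beta$ such that (i) $\{\pi_1,\pi_2\},\dots,\{\pi_{p-1},\pi_p\}$ are pairwise different diagonals; (ii) no $\{\pi_i,\pi_{i+1}\}$ crosses a diagonal in $D$; (iii) the diagonals $\{\pi_{2j},\pi_{2j+1}\}$ are in $D$ and, with $P$ realised as a convex polygon in the plane, they cross $\{\alpha,\beta\}$ at pairwise different points which progress monotonically in the direction from $\alpha$ to $\beta$. Theorem. The map $f$ is a weak frieze with respect to $D$ if and only if it satisfies the $T$-path formula with respect to $D$: for all vertices $\alpha\neq\beta$, $$f(\alpha,\beta)=\sum_{\pi}\frac{\prod_{i\text{ odd}}f(\pi_i,\pi_{i+1})}{\prod_{j\text{ even}}f(\pi_j,\pi_{j+1})},$$ where the sum is over the (finitely many) $T$-paths $\pi=(\pi_1,\dots,\pi_p)$ from $\alpha$ to $\beta$ with respect to $D$, and the products are over the odd, respectively even, indices in $\{1,\dots,p-1\}$. -/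

import Mathlib

/-!
A polygon is its finite set `V` of at least three vertices with a cyclic order, that is
`[Fintype V] [CircularOrder V]` and `3 ≤ Fintype.card V`; `sbtw a b c` says that `a, b, c` are
distinct and are met in this order when moving in the positive direction.

A semifield is a type `K` with `[CommGroup K] [AddCommSemigroup K] [LeftDistribClass K]`: a
commutative group under multiplication, a commutative semigroup under addition, and a
multiplication that distributes over addition (there is neither a zero nor a subtraction).
-/

namespace WeakFrieze

/-- The set of diagonals of the polygon with vertex set `V`: unordered pairs of distinct
vertices. Edges of the polygon are included. -/
abbrev Diagonal (V : Type*) : Type _ := {d : Sym2 V // ¬ d.IsDiag}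

section Polygon

variable {V : Type*} [CircularOrder V]

/-- `d = {α, β}` and `e = {γ, δ}` cross: `α, β, γ, δ` are four distinct vertices which appear in
the order `α, γ, β, δ` (the names of the end points of `d` and of `e` may be exchanged). -/
def Crosses (d e : Sym2 V) : Prop :=
  ∃ α β γ δ : V, d = s(α, β) ∧ e = s(γ, δ) ∧ sbtw α γ β ∧ sbtw β δ α

/-- `β` is the successor of `α` in the cyclic order. -/
def IsSucc (α β : V) : Prop := α ≠ β ∧ ∀ γ : V, ¬ sbtw α γ β

/-- `d` is an internal diagonal: a pair of distinct vertices that is not of the form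
`{α, α⁺}`. -/
def IsInternal (d : Sym2 V) : Prop := ¬ d.IsDiag ∧ ∀ α β : V, d = s(α, β) → ¬ IsSucc α β

/-- A dissection: a set of pairwise non-crossing internal diagonals (possibly empty). -/
structure IsDissection (D : Set (Sym2 V)) : Prop where
  internal : ∀ d ∈ D, IsInternal d
  noncrossing : ∀ d ∈ D, ∀ e ∈ D, ¬ Crosses d e

/-- `d` and `e` both cross `{α, β}`, and when moving along `{α, β}` from `α` to `β` one
meets `d` strictly before `e`, for diagonals `d`, `e` that do not cross each other. Here `γ, γ'` are
the end points of `d, e` passed when moving in the positive direction from `α` to `β`, and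
`δ, δ'` are those passed when moving in the positive direction from `β` to `α`; that `d` comes
first means that on both sides the end point of `d` is not farther from `α` than that of `e`
(a common end point is allowed, but `d ≠ e`). -/
def CrossesBefore (α β : V) (d e : Sym2 V) : Prop :=
  d ≠ e ∧ ∃ γ δ γ' δ' : V, d = s(γ, δ) ∧ e = s(γ', δ') ∧
    (sbtw α γ β ∧ sbtw β δ α) ∧ (sbtw α γ' β ∧ sbtw β δ' α) ∧
    (γ = γ' ∨ sbtw α γ γ') ∧ (δ = δ' ∨ sbtw β δ' δ)

end Polygon

/-- The list `{π₁, π₂}, {π₂, π₃}, …, {πₚ₋₁, πₚ}` of a tuple `(π₁, …, πₚ)`. -/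
def steps {V : Type*} : List V → List (Sym2 V)
  | [] => []
  | [_] => []
  | a :: b :: l => s(a, b) :: steps (b :: l)

/-- The first, third, fifth, … entries of a list. -/
def oddTerms {A : Type*} : List A → List A
  | [] => []
  | [a] => [a]
  | a :: _ :: l => a :: oddTerms l

/-- The second, fourth, sixth, … entries of a list. -/
def evenTerms {A : Type*} (l : List A) : List A := oddTerms l.tail

section TPaths

variable {V : Type*} [CircularOrder V]

/-- `π = (π₁, …, πₚ)` is a `T`-path from `α` to `β` with respect to `D` (used for `α ≠ β`). -/
structure IsTPath (D : Set (Sym2 V)) (α β : V) (π : List V) : Prop where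
  first : π.head? = some α
  last : π.getLast? = some β
  isDiagonal : ∀ d ∈ steps π, ¬ d.IsDiag
  nodup : (steps π).Nodup
  noncrossing : ∀ d ∈ steps π, ∀ e ∈ D, ¬ Crosses d e
  even_mem : ∀ d ∈ evenTerms (steps π), d ∈ D
  even_crosses : ∀ d ∈ evenTerms (steps π), Crosses d s(α, β)
  monotone : (evenTerms (steps π)).Pairwise (CrossesBefore α β)

theorem length_le_length_steps {V : Type*} (π : List V) : π.length ≤ (steps π).length + 1 := by
  induction π with
  | nil => simp
  | cons a l ih =>
    cases l with
    | nil => simp [steps]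
    | cons b l => simp only [steps, List.length_cons] at ih ⊢; omega

theorem finite_setOf_isTPath [Finite V] (D : Set (Sym2 V)) (α β : V) :
    {π : List V | IsTPath D α β π}.Finite := by
  classical
  have := Fintype.ofFinite V
  refine (List.finite_length_le V (Fintype.card (Sym2 V) + 1)).subset fun π hπ => ?_
  have h1 := length_le_length_steps π
  have h2 := hπ.nodup.length_le_card
  simp only [Set.mem_ofPred_eq]
  omega

/-- The finite set of `T`-paths from `α` to `β` with respect to `D`. -/
noncomputable def tPaths [Finite V] (D : Set (Sym2 V)) (α β : V) : Finset (List V) :=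
  (finite_setOf_isTPath D α β).toFinset

end TPaths

section Values

variable {V K : Type*} [CommGroup K]

open Classical in
/-- The value of `f : diag(P) → K` on an unordered pair `d` of vertices. It is only ever used when
`d` is a diagonal; on the pairs `{α, α}` it has the dummy value `1`. -/
noncomputable def value (f : Diagonal V → K) (d : Sym2 V) : K :=
  if h : ¬ d.IsDiag then f ⟨d, h⟩ else 1

/-- `f(π) = ∏_{i odd} f(πᵢ, πᵢ₊₁) / ∏_{j even} f(πⱼ, πⱼ₊₁)`. -/
noncomputable def pathValue (f : Diagonal V → K) (π : List V) : K :=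
  ((oddTerms (steps π)).map (value f)).prod / ((evenTerms (steps π)).map (value f)).prod

variable [CircularOrder V] [AddCommSemigroup K]

/-- `f` is a weak frieze with respect to `D`: the Ptolemy relation holds for crossing diagonals
`{α, β}` and `{γ, δ}` with `{γ, δ}` in `D`. -/
def IsWeakFrieze (D : Set (Sym2 V)) (f : Diagonal V → K) : Prop :=
  ∀ α β γ δ : V, Crosses s(α, β) s(γ, δ) → s(γ, δ) ∈ D →
    value f s(α, β) * value f s(γ, δ) =
      value f s(α, γ) * value f s(β, δ) + value f s(α, δ) * value f s(β, γ)

/-- `f` satisfies the `T`-path formula with respect to `D`. As `K` has no zero, the finite sum is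
formed in `WithZero K`, which is `K` with a new neutral element of addition adjoined: a sum over a
nonempty set of `T`-paths is the sum in `K`, and a sum over no `T`-paths would equal no element
of `K`. -/
def SatisfiesTPathFormula [Finite V] (D : Set (Sym2 V)) (f : Diagonal V → K) : Prop :=
  ∀ α β : V, α ≠ β →
    ((value f s(α, β) : K) : WithZero K) = ∑ π ∈ tPaths D α β, ((pathValue f π : K) : WithZero K)

end Values

end WeakFrieze

namespace WeakFrieze

/-! ### Positions in a cyclic order cut open at one vertex. -/

section Geometry

variable {V : Type*} [CircularOrder V]

/-! Both properties are equivalent to a third one, `FirstPtolemy`: the Ptolemy relation is only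
required for `{α, β}` and the first diagonal `{c, d}` of `D` met on the way from `α` to `β`.

For the `T`-path formula, the second vertex of a `T`-path from `α` must be `c` or `d`. Those through
`c` biject with the `T`-paths from `d` to `β`: a path `(d, c, …)` becomes `(α, c, …)`, and any other
path from `d` is prefixed by `α, c`. In both cases the value is multiplied by `f(α, c) / f(c, d)`.
Hence the path sums satisfy the recursion `IsFirst.sum_pathValue`, which is the Ptolemy relation at
`{c, d}` divided by `f(c, d)`. The formula therefore gives `FirstPtolemy` at once. The converse is
an induction on the number of diagonals of `D` crossing `{α, β}`, which is smaller for `{d, β}` and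
`{c, β}`.

A weak frieze satisfies `FirstPtolemy` trivially. Conversely, for a later `{γ, δ}` in `D`, the same
induction gives the relations of `{γ, δ}` with `{d, β}` and `{c, β}`; those of `{c, d}` with `{α,
γ}` and `{α, δ}` are again first-diagonal relations. They combine (`ptolemy_step`) by expanding and
cancelling `f(c, d)`, so neither zero nor subtraction is needed.

The planar geometry becomes linear arithmetic on the positions given by `exists_position`. -/

theorem sbtw_or_sbtw_of_ne {a b c : V} (hab : a ≠ b) (hbc : b ≠ c) (hac : a ≠ c) :
    sbtw a b c ∨ sbtw c b a := by
  by_contra! h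
  rw [sbtw_iff_not_btw, sbtw_iff_not_btw, not_not, not_not] at h
  rcases btw_antisymm h.2 h.1 with h' | h' | h' <;> grind

/-- A finite cyclic order, cut open at `o`, is the cyclic order induced by an injection into `ℕ`
that sends `o` to `0`. -/
theorem exists_position [Finite V] (o : V) :
    ∃ p : V → ℕ, Function.Injective p ∧ p o = 0 ∧ ∀ a b c, sbtw a b c ↔
      (p a < p b ∧ p b < p c) ∨ (p b < p c ∧ p c < p a) ∨ (p c < p a ∧ p a < p b) := by
  classical
  -- The position counts the vertices strictly between `o` and `v`; the `+ 1` reserves `0` for `o`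
  -- itself.
  let p : V → ℕ := fun v => if v = o then 0 else {w | sbtw o w v}.ncard + 1
  have ho : p o = 0 := by simp [p]
  have hpos : ∀ a, a ≠ o → 0 < p a := fun a ha => by simp [p, ha]
  have hlt : ∀ a b, sbtw o a b → p a < p b := by
    intro a b h
    have ha : a ≠ o := by rintro rfl; exact sbtw_irrefl_left h
    have hb : b ≠ o := by rintro rfl; exact sbtw_irrefl_left_right h
    simp only [p, ha, hb, if_false]
    refine Nat.succ_lt_succ (Set.ncard_lt_ncard ⟨fun w hw => ?_, fun hs => ?_⟩ (Set.toFinite _))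
    · exact sbtw_trans_right (show sbtw o w a from hw) h
    · exact sbtw_irrefl_right (hs (show sbtw o a b from h))
  have hbase : ∀ a b, a ≠ o → b ≠ o → a ≠ b → (sbtw o a b ∨ sbtw o b a) := by
    intro a b ha hb hab
    rcases sbtw_or_sbtw_of_ne ha.symm hab hb.symm with h | h
    · exact .inl h
    · exact .inr (sbtw_cyclic_right h)
  have hinj : Function.Injective p := by
    intro a b hab
    by_contra hne
    by_cases ha : a = o
    · have := hpos b (by grind); grind
    by_cases hb : b = o
    · have := hpos a (by grind); grind
    rcases hbase a b ha hb hne with h | h <;> have := hlt _ _ h <;> omega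
  have hinc : ∀ a b c, p a < p b → p b < p c → sbtw a b c := by
    intro a b c hab hbc
    have hb : b ≠ o := by rintro rfl; omega
    have hc : c ≠ o := by rintro rfl; omega
    have h2 : sbtw o b c := by
      rcases hbase b c hb hc (by rintro rfl; omega) with h | h
      · exact h
      · have := hlt _ _ h; omega
    by_cases ha : a = o
    · rwa [ha]
    have h1 : sbtw o a b := by
      rcases hbase a b ha hb (by rintro rfl; omega) with h | h
      · exact h
      · have := hlt _ _ h; omega
    exact sbtw_cyclic_left (sbtw_trans_left (sbtw_cyclic_right h2) h1)
  refine ⟨p, hinj, ho, fun a b c => ⟨fun h => ?_, ?_⟩⟩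
  · have h1 : p a ≠ p b := fun e => sbtw_irrefl_left (hinj e ▸ h)
    have h2 : p b ≠ p c := fun e => sbtw_irrefl_right (hinj e ▸ h)
    have h3 : p a ≠ p c := fun e => sbtw_irrefl_left_right (hinj e ▸ h)
    by_contra hcon
    have hneg : ¬ sbtw c b a := sbtw_asymm h
    rcases lt_or_gt_of_ne h1 with h1 | h1 <;> rcases lt_or_gt_of_ne h2 with h2 | h2 <;>
      rcases lt_or_gt_of_ne h3 with h3 | h3 <;> try omega
    · exact hneg (sbtw_cyclic_left (hinc a c b (by omega) (by omega)))
    · exact hneg (sbtw_cyclic_right (hinc b a c (by omega) (by omega)))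
    · exact hneg (hinc _ _ _ (by omega) (by omega))
  · rintro (h | h | h)
    · exact hinc _ _ _ h.1 h.2
    · exact sbtw_cyclic_right (hinc _ _ _ h.1 h.2)
    · exact sbtw_cyclic_left (hinc _ _ _ h.1 h.2)

/-- The special cases of `exists_position` in which one of the three vertices is the base. -/
theorem exists_position' [Finite V] (o : V) :
    ∃ p : V → ℕ, (∀ a b, a = b ↔ p a = p b) ∧ p o = 0 ∧
      (∀ a b, sbtw o a b ↔ 0 < p a ∧ p a < p b) ∧ (∀ a b, sbtw a b o ↔ 0 < p a ∧ p a < p b) ∧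
      ∀ a b c, sbtw a b c ↔
        (p a < p b ∧ p b < p c) ∨ (p b < p c ∧ p c < p a) ∨ (p c < p a ∧ p a < p b) := by
  obtain ⟨p, hp, h0, hs⟩ := exists_position o
  refine ⟨p, fun a b => hp.eq_iff.symm, h0, fun a b => ?_, fun a b => ?_, hs⟩ <;> rw [hs] <;> omega

end Geometry

/-! ### Crossings and the first diagonal met by `{α, β}`. -/

section Geometry

variable {V : Type*} [CircularOrder V]

theorem crosses_mk {a b c d : V} : Crosses s(a, b) s(c, d) ↔
    (sbtw a c b ∧ sbtw b d a) ∨ (sbtw a d b ∧ sbtw b c a) := by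
  constructor
  · rintro ⟨x, y, z, w, h1, h2, h3, h4⟩
    rcases Sym2.eq_iff.1 h1 with ⟨rfl, rfl⟩ | ⟨rfl, rfl⟩ <;>
      rcases Sym2.eq_iff.1 h2 with ⟨rfl, rfl⟩ | ⟨rfl, rfl⟩ <;> grind
  · rintro (h | h)
    · exact ⟨a, b, c, d, rfl, rfl, h⟩
    · exact ⟨a, b, d, c, rfl, Sym2.eq_swap, h⟩

/-- The side of `{α, β}` on which each end point lies is prescribed, so only one labelling can
witness the existential. -/
theorem crossesBefore_mk {α β x y z w : V} (h1 : sbtw α x β) (h2 : sbtw β y α)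
    (h3 : sbtw α z β) (h4 : sbtw β w α) : CrossesBefore α β s(x, y) s(z, w) ↔
      s(x, y) ≠ s(z, w) ∧ (x = z ∨ sbtw α x z) ∧ (y = w ∨ sbtw β w y) := by
  constructor
  · rintro ⟨h0, a, b, a', b', e1, e2, h5, h6, h7⟩
    have hx := sbtw_asymm h1
    have hz := sbtw_asymm h3
    rcases Sym2.eq_iff.1 e1 with ⟨rfl, rfl⟩ | ⟨rfl, rfl⟩
    · rcases Sym2.eq_iff.1 e2 with ⟨rfl, rfl⟩ | ⟨rfl, rfl⟩
      · exact ⟨h0, h7⟩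
      · exact absurd h6.2 hz
    · exact absurd h5.2 hx
  · rintro ⟨h0, h⟩
    exact ⟨h0, x, y, z, w, rfl, rfl, ⟨h1, h2⟩, ⟨h3, h4⟩, h⟩

/-- `{c, d}` is the first diagonal in `D` met when moving along `{α, β}` from `α` to `β`. -/
structure IsFirst (D : Set (Sym2 V)) (α β c d : V) : Prop where
  mem : s(c, d) ∈ D
  crosses : Crosses s(c, d) s(α, β)
  before : ∀ e ∈ D, Crosses e s(α, β) → e ≠ s(c, d) → CrossesBefore α β s(c, d) e

theorem IsFirst.symm {D : Set (Sym2 V)} {α β c d : V} (h : IsFirst D α β c d) :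
    IsFirst D α β d c := by
  have := Sym2.eq_swap (a := c) (b := d)
  exact ⟨this ▸ h.mem, this ▸ h.crosses, this ▸ h.before⟩

variable [Finite V] {D : Set (Sym2 V)} {α β c d : V}

theorem crosses_comm {d e : Sym2 V} : Crosses d e ↔ Crosses e d := by
  induction d with | _ a b
  induction e with | _ x y
  obtain ⟨p, hp, h0, hs⟩ := exists_position a
  simp only [crosses_mk, hs]
  omega

theorem crosses_iff_exists {e : Sym2 V} {α β : V} : Crosses e s(α, β) ↔
    ∃ γ δ, e = s(γ, δ) ∧ sbtw α γ β ∧ sbtw β δ α := by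
  rw [crosses_comm]
  constructor
  · rintro ⟨a, b, c, d, h1, h2, h3, h4⟩
    rcases Sym2.eq_iff.1 h1 with ⟨rfl, rfl⟩ | ⟨rfl, rfl⟩
    · exact ⟨c, d, h2, h3, h4⟩
    · exact ⟨d, c, h2.trans Sym2.eq_swap, h4, h3⟩
  · rintro ⟨c, d, h2, h3, h4⟩
    exact ⟨α, β, c, d, rfl, h2, h3, h4⟩

theorem Crosses.not_mem {e : Sym2 V} (h : Crosses e s(α, β)) : α ∉ e ∧ β ∉ e := by
  obtain ⟨γ, δ, rfl, h1, h2⟩ := crosses_iff_exists.1 h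
  obtain ⟨p, hp, h0, hl, hr, hs⟩ := exists_position' α
  simp only [hl, hr, Sym2.mem_iff, hp] at h1 h2 ⊢
  omega

theorem Crosses.ne {e : Sym2 V} (h : Crosses e s(α, β)) : α ≠ β := by
  obtain ⟨γ, δ, rfl, h1, h2⟩ := crosses_iff_exists.1 h
  rintro rfl
  exact sbtw_irrefl_left_right h1

/-- A vertex of the first diagonal which lies on a later one lies on everything in between. -/
theorem CrossesBefore.mem_of_mem {e e' : Sym2 V} (h : CrossesBefore α β s(c, d) e)
    (h' : CrossesBefore α β e e') (hd : d ∈ e') : d ∈ e := by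
  obtain ⟨-, a, b, a', b', rfl, rfl, h3, h4, h5, h6⟩ := h'
  obtain ⟨-, x, y, z, w, e1, e2, hx, hz, hxz, hyw⟩ := h
  have := sbtw_asymm h3.1
  obtain ⟨rfl, rfl⟩ : a = z ∧ b = w := by
    rcases Sym2.eq_iff.1 e2 with h | ⟨rfl, rfl⟩
    · exact h
    · exact absurd hz.2 this
  obtain ⟨p, hp, -, hl, hr, hs⟩ := exists_position' α
  rcases Sym2.eq_iff.1 e1 with ⟨rfl, rfl⟩ | ⟨rfl, rfl⟩ <;>
  · simp only [hl, hr] at h3 h4 h5 hx hxz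
    simp only [Sym2.mem_iff, hs, hp] at h5 h6 hxz hyw hd ⊢
    omega

/-- The diagonals in `D` that cross `{α, β}`, and the first of them, in terms of positions. -/
theorem IsFirst.exists_before (h : IsFirst D α β c d) {e : Sym2 V} (he : e ∈ D)
    (hc : Crosses e s(α, β)) : ∃ x y, e = s(x, y) ∧ (sbtw α x β ∧ sbtw β y α) ∧
      ((sbtw α c β ∧ sbtw β d α ∧ (c = x ∨ sbtw α c x) ∧ (d = y ∨ sbtw β y d)) ∨
        (sbtw α d β ∧ sbtw β c α ∧ (d = x ∨ sbtw α d x) ∧ (c = y ∨ sbtw β y c))) := by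
  by_cases hne : e = s(c, d)
  · obtain ⟨x, y, e1, h1, h2⟩ := crosses_iff_exists.1 h.crosses
    refine ⟨x, y, hne.trans e1, ⟨h1, h2⟩, ?_⟩
    rcases Sym2.eq_iff.1 e1 with ⟨rfl, rfl⟩ | ⟨rfl, rfl⟩
    · exact .inl ⟨h1, h2, .inl rfl, .inl rfl⟩
    · exact .inr ⟨h1, h2, .inl rfl, .inl rfl⟩
  · obtain ⟨-, x, y, z, w, e1, e2, h1, h2, h3⟩ := h.before e he hc hne
    refine ⟨z, w, e2, h2, ?_⟩
    rcases Sym2.eq_iff.1 e1 with ⟨rfl, rfl⟩ | ⟨rfl, rfl⟩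
    · exact .inl ⟨h1.1, h1.2, h3⟩
    · exact .inr ⟨h1.1, h1.2, h3⟩

/-- As `e` does not cross `{c, d}`, both `c` and `d` lie in one closed side of `e`, and the
hypothesis puts `β` (or `α`) strictly on the other side. If `α` and `β` were both in the closure of
that other side, so would be an arc between them, with `c` or `d` in its interior. -/
theorem IsFirst.crosses_of_crosses (hD : IsDissection D) (h : IsFirst D α β c d) {e : Sym2 V}
    (he : e ∈ D) (h' : Crosses e s(d, β) ∨ Crosses e s(α, c)) : Crosses e s(α, β) := by
  have hn := hD.noncrossing _ h.mem _ he
  have h3 : (sbtw α c β ∧ sbtw β d α) ∨ (sbtw α d β ∧ sbtw β c α) := by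
    obtain ⟨x, y, e1, h⟩ := crosses_iff_exists.1 h.crosses
    rcases Sym2.eq_iff.1 e1 with ⟨rfl, rfl⟩ | ⟨rfl, rfl⟩
    · exact .inl h
    · exact .inr h
  rcases h' with h' | h'
  · obtain ⟨x, y, rfl, h1, h2⟩ := crosses_iff_exists.1 h'
    obtain ⟨p, hp, h0, hl, hr, hs⟩ := exists_position' d
    rw [crosses_mk] at hn ⊢
    simp only [hl, hr] at h1 h2 h3 hn
    simp only [hs] at h3 hn ⊢
    simp only [h1.1, h1.2, h2.1, h2.2, h0, not_lt_zero, false_and, and_false, or_false,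
      false_or, true_and, and_true, h1.2.trans h2.2,
      not_lt_of_gt h2.2, not_lt_of_gt h1.2, not_lt_of_gt (h1.2.trans h2.2)] at h3 hn ⊢
    rcases h3 with h3 | h3 <;> omega
  · obtain ⟨x, y, rfl, h1, h2⟩ := crosses_iff_exists.1 h'
    obtain ⟨p, hp, h0, hl, hr, hs⟩ := exists_position' α
    rw [crosses_mk] at hn ⊢
    simp only [hl, hr] at h1 h2 h3 hn ⊢
    simp only [hs] at h3 hn ⊢
    simp only [h1.1, h1.2, h2.1, h2.2, h0, not_lt_zero, false_and, and_false, or_false,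
      false_or, true_and, and_true, h1.2.trans h2.2,
      not_lt_of_gt h2.2, not_lt_of_gt h1.2, not_lt_of_gt (h1.2.trans h2.2)] at h3 hn ⊢
    rcases h3 with h3 | h3 <;> omega

/-- Diagonals of `D` crossing `{α, β}` lie weakly beyond `{c, d}`, so one that avoids `d` has `d`
strictly on the side of `α`. This controls the passage from `α` to `d` in the recursion. -/
theorem IsFirst.crosses_iff (hD : IsDissection D) (h : IsFirst D α β c d) {e : Sym2 V}
    (he : e ∈ D) : Crosses e s(d, β) ↔ Crosses e s(α, β) ∧ d ∉ e := by
  refine ⟨fun h' => ⟨h.crosses_of_crosses hD he (.inl h'), h'.not_mem.1⟩, ?_⟩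
  rintro ⟨h1, h2⟩
  obtain ⟨x, y, rfl, hx, hy⟩ := h.exists_before he h1
  rw [crosses_mk]
  obtain ⟨p, hp, h0, hl, hr, hs⟩ := exists_position' α
  simp only [hl, hr] at hx hy ⊢
  simp only [Sym2.mem_iff, hs, hp] at hx hy h2 ⊢
  omega

/-- Both diagonals have `d` strictly on the side of `α`, so moving the starting point from `α` to
`d` changes neither the sides nor the order of their end points. -/
theorem IsFirst.crossesBefore_iff (h : IsFirst D α β c d) {e e' : Sym2 V}
    (h1 : e ∈ D) (h2 : e' ∈ D) (h3 : Crosses e s(α, β)) (h4 : Crosses e' s(α, β))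
    (h5 : d ∉ e) (h6 : d ∉ e') : CrossesBefore d β e e' ↔ CrossesBefore α β e e' := by
  obtain ⟨x, y, rfl, hx, hy⟩ := h.exists_before h1 h3
  obtain ⟨z, w, rfl, hz, hw⟩ := h.exists_before h2 h4
  rw [crossesBefore_mk hx.1 hx.2 hz.1 hz.2]
  obtain ⟨p, hp, h0, hl, hr, hs⟩ := exists_position' α
  rw [crossesBefore_mk]
  · refine and_congr_right fun _ => ?_
    simp only [hl, hr] at hx hy hz hw ⊢
    simp only [Sym2.mem_iff, hs, hp] at hx hy hz hw h5 h6 ⊢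
    omega
  all_goals
    simp only [hl, hr] at hx hy hz hw
    simp only [Sym2.mem_iff, hs, hp] at hx hy hz hw h5 h6 ⊢
    omega

/-- Such an `e` would also cross `{α, β}`, hence lie weakly beyond `{c, d}`, and then it could not
separate `c` from `α`. -/
theorem IsFirst.not_crosses (hD : IsDissection D) (h : IsFirst D α β c d) {e : Sym2 V}
    (he : e ∈ D) : ¬ Crosses e s(α, c) := by
  intro h'
  obtain ⟨x, y, rfl, hx, hy⟩ := h.exists_before he (h.crosses_of_crosses hD he (.inr h'))
  rw [crosses_mk] at h'
  obtain ⟨p, hp, h0, hl, hr, hs⟩ := exists_position' α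
  simp only [hl, hr] at hx hy h'
  simp only [hs, hp] at hx hy h'
  omega

/-- The end points of `e` are weakly beyond `c` and `d`; if `v` were strictly beyond, `{c, d}` would
separate it from `α`. -/
theorem IsFirst.mem_of_not_crosses (h : IsFirst D α β c d) {v : V} {e : Sym2 V} (he : e ∈ D)
    (h1 : Crosses e s(α, β)) (hv : v ∈ e) (h2 : ¬ Crosses s(α, v) s(c, d)) :
    v = c ∨ v = d := by
  obtain ⟨x, y, rfl, hx, hy⟩ := h.exists_before he h1
  rw [crosses_mk] at h2
  obtain ⟨p, hp, h0, hl, hr, hs⟩ := exists_position' α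
  simp only [hl, hr] at hx hy h2
  simp only [Sym2.mem_iff, hs, hp] at hx hy h2 hv ⊢
  omega

theorem exists_isFirst (hD : IsDissection D) {e : Sym2 V} (he : e ∈ D)
    (h : Crosses e s(α, β)) : ∃ c d, IsFirst D α β c d := by
  obtain ⟨p, hp, h0, hl, hr, hs⟩ := exists_position' α
  obtain ⟨g, k, rfl, h1, h2⟩ := crosses_iff_exists.1 h
  -- Moving away from `α`, positions increase on the side of `c` and decrease on the side of `d`, so
  -- the minimised quantity adds up the distances on both sides, up to a constant. Non-crossing
  -- diagonals are ordered the same way on both sides, so a minimal sum is minimal in each.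
  obtain ⟨⟨c, d⟩, ⟨hc1, hc2, hc3⟩, hmin⟩ := Set.exists_min_image
    {q : V × V | s(q.1, q.2) ∈ D ∧ sbtw α q.1 β ∧ sbtw β q.2 α}
    (fun q => (p q.1 : ℤ) - p q.2) (Set.toFinite _) ⟨(g, k), he, h1, h2⟩
  refine ⟨c, d, hc1, crosses_iff_exists.2 ⟨c, d, rfl, hc2, hc3⟩, fun e he hc hne => ?_⟩
  obtain ⟨x, y, rfl, h3, h4⟩ := crosses_iff_exists.1 hc
  refine ⟨hne.symm, c, d, x, y, rfl, rfl, ⟨hc2, hc3⟩, ⟨h3, h4⟩, ?_⟩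
  have hm := hmin (x, y) ⟨he, h3, h4⟩
  have hn := hD.noncrossing _ hc1 _ he
  rw [crosses_mk] at hn
  simp only [hl, hr] at hc2 hc3 h3 h4 hn ⊢
  simp only [hs, hp] at hc2 hc3 h3 h4 hn hm ⊢
  omega

/-- If the far end is moved back to a vertex of another crossing diagonal, the first diagonal
stays the same. -/
theorem IsFirst.of_mem (hD : IsDissection D) (h : IsFirst D α β c d) {γ : V} {g : Sym2 V}
    (hg : g ∈ D) (hgc : Crosses g s(α, β)) (hγ : γ ∈ g) (h1 : γ ≠ c) (h2 : γ ≠ d) :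
    IsFirst D α γ c d := by
  obtain ⟨x, y, rfl, hx, hy⟩ := h.exists_before hg hgc
  obtain ⟨p, hp, h0, hl, hr, hs⟩ := exists_position' α
  refine ⟨h.mem, ?_, fun e he hce hne => ?_⟩
  · rw [crosses_mk]
    simp only [hl, hr] at hx hy ⊢
    simp only [Sym2.mem_iff, hs, hp, ne_eq] at hx hy hγ h1 h2 ⊢
    omega
  · have hn := hD.noncrossing _ hg _ he
    -- `g` does not cross `e`, so it lies in the closed side of `e` that contains `γ`, away from
    -- `α`; since `g` separates `α` from `β`, the vertex `β` is beyond `e` too.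
    have hc : Crosses e s(α, β) := by
      induction e with | _ u v
      rw [crosses_mk] at hn hce ⊢
      simp only [hl, hr] at hx hn hce ⊢
      simp only [Sym2.mem_iff, hs, hp] at hx hn hce hγ ⊢
      omega
    obtain ⟨u, v, rfl, hu, hv⟩ := h.exists_before he hc
    suffices ((sbtw α c γ ∧ sbtw γ d α) ∧ (sbtw α u γ ∧ sbtw γ v α) ∧
      (c = u ∨ sbtw α c u) ∧ (d = v ∨ sbtw γ v d)) ∨
      ((sbtw α d γ ∧ sbtw γ c α) ∧ (sbtw α u γ ∧ sbtw γ v α) ∧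
      (d = u ∨ sbtw α d u) ∧ (c = v ∨ sbtw γ v c)) by
      rcases this with this | this
      · exact ⟨hne.symm, c, d, u, v, rfl, rfl, this⟩
      · exact ⟨hne.symm, d, c, u, v, Sym2.eq_swap, rfl, this⟩
    rw [crosses_mk] at hce
    simp only [hl, hr] at hx hy hu hv hce ⊢
    simp only [Sym2.mem_iff, hs, hp, ne_eq] at hx hy hu hv hce hγ h1 h2 ⊢
    omega

end Geometry

/-! ### Steps of a tuple and their alternate terms. -/

section Lists

variable {A : Type*}

@[simp] theorem steps_cons_cons (a b : A) (l : List A) :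
    steps (a :: b :: l) = s(a, b) :: steps (b :: l) := rfl

@[simp] theorem evenTerms_cons_cons (a b : A) (l : List A) :
    evenTerms (a :: b :: l) = b :: evenTerms l := by
  cases l <;> rfl

theorem oddTerms_cons (a : A) (l : List A) : oddTerms (a :: l) = a :: evenTerms l := by
  cases l <;> rfl

theorem evenTerms_cons (a : A) (l : List A) : evenTerms (a :: l) = oddTerms l := rfl

theorem mem_of_mem_steps {l : List A} {d : Sym2 A} {v : A} (hd : d ∈ steps l) (hv : v ∈ d) :
    v ∈ l := by
  induction l with
  | nil => simp [steps] at hd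
  | cons a l ih =>
    cases l with
    | nil => simp [steps] at hd
    | cons b l =>
      simp only [steps_cons_cons, List.mem_cons] at hd
      rcases hd with rfl | hd
      · rcases Sym2.mem_iff.1 hv with rfl | rfl <;> simp
      · exact List.mem_cons_of_mem _ (ih hd)

/-- Each vertex of a path except the first and the last is an end point of an even step. -/
theorem mem_even_of_mem_tail (n : ℕ) : ∀ (l : List A) (a v : A), l.length ≤ n → v ∈ l →
    (∃ e ∈ evenTerms (steps (a :: l)), v ∈ e) ∨ l.getLast? = some v := by
  induction n with
  | zero => intro l a v hl hv; simp_all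
  | succ n ih =>
    rintro (_ | ⟨b, _ | ⟨c, l⟩⟩) a v hl hv
    · simp at hv
    · simp_all
    · simp only [steps_cons_cons, evenTerms_cons_cons, List.mem_cons] at hv ⊢
      rcases hv with rfl | rfl | hv
      · exact .inl ⟨_, .inl rfl, by simp⟩
      · exact .inl ⟨_, .inl rfl, by simp⟩
      · rcases ih l c v (by simp at hl; omega) hv with ⟨e, he, hve⟩ | h
        · exact .inl ⟨e, .inr he, hve⟩
        · right; cases l with
          | nil => simp at hv
          | cons x l => simpa using h

end Lists

/-! ### Changing the initial segment of a `T`-path. -/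

section TPaths

variable {V : Type*} [CircularOrder V] {D : Set (Sym2 V)} {α β c d : V}

theorem IsTPath.exists_eq_cons {π : List V} (h : IsTPath D α β π) : ∃ τ, π = α :: τ := by
  have := h.first
  cases π <;> simp_all

theorem IsTPath.not_mem_tail {τ : List V} (h : IsTPath D α β (α :: τ)) {v : V}
    (hv : v ≠ β) (hv' : ∀ e ∈ evenTerms (steps (α :: τ)), v ∉ e) : v ∉ τ := by
  intro hm
  rcases mem_even_of_mem_tail _ τ α v le_rfl hm with ⟨e, he, hve⟩ | h'
  · exact hv' e he hve
  · have := h.last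
    cases τ with
    | nil => simp at hm
    | cons x τ => simp_all

variable [Finite V]

theorem mem_tPaths {π : List V} : π ∈ tPaths D α β ↔ IsTPath D α β π := by
  simp [tPaths]

/-- The second vertex lies on the first crossing diagonal. -/
theorem IsTPath.exists_eq (hF : IsFirst D α β c d) {π : List V}
    (h : IsTPath D α β π) :
    (∃ x r, π = α :: c :: x :: r) ∨ (∃ x r, π = α :: d :: x :: r) := by
  obtain ⟨τ, rfl⟩ := h.exists_eq_cons
  rcases τ with _ | ⟨v, _ | ⟨x, r⟩⟩
  · exact absurd (by simpa using h.last) hF.crosses.ne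
  · have := h.last
    simp only [List.getLast?_cons_cons, List.getLast?_singleton, Option.some.injEq] at this
    subst this
    exact absurd (crosses_comm.1 hF.crosses) (h.noncrossing _ (by simp) _ hF.mem)
  · have := hF.mem_of_not_crosses (v := v) (e := s(v, x)) (h.even_mem _ (by simp))
      (h.even_crosses _ (by simp)) (by simp) (h.noncrossing _ (by simp) _ hF.mem)
    rcases this with rfl | rfl
    · exact .inl ⟨_, _, rfl⟩
    · exact .inr ⟨_, _, rfl⟩

theorem IsFirst.ne (hF : IsFirst D α β c d) (hD : IsDissection D) :
    α ≠ c ∧ α ≠ d ∧ β ≠ c ∧ β ≠ d ∧ c ≠ d := by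
  have h1 := hF.crosses.not_mem
  have h2 := (hD.internal _ hF.mem).1
  simp only [Sym2.mem_iff, Sym2.mk_isDiag_iff] at h1 h2
  tauto

/-- Paths that agree in their even steps, seen from the two starting points. -/
theorem IsFirst.even_of_even (hD : IsDissection D) (hF : IsFirst D α β c d) {L : List (Sym2 V)}
    (h1 : ∀ e ∈ L, e ∈ D) (h2 : ∀ e ∈ L, Crosses e s(α, β)) (h3 : ∀ e ∈ L, d ∉ e)
    (h4 : L.Pairwise (CrossesBefore α β)) :
    (∀ e ∈ L, Crosses e s(d, β)) ∧ L.Pairwise (CrossesBefore d β) := by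
  refine ⟨fun e he => (hF.crosses_iff hD (h1 e he)).2 ⟨h2 e he, h3 e he⟩, ?_⟩
  exact h4.imp_of_mem fun {a b} ha hb hab => (hF.crossesBefore_iff (h1 a ha) (h1 b hb) (h2 a ha)
    (h2 b hb) (h3 a ha) (h3 b hb)).2 hab

theorem IsFirst.even_of_even' (hD : IsDissection D) (hF : IsFirst D α β c d) {L : List (Sym2 V)}
    (h1 : ∀ e ∈ L, e ∈ D) (h2 : ∀ e ∈ L, Crosses e s(d, β))
    (h4 : L.Pairwise (CrossesBefore d β)) :
    (∀ e ∈ L, Crosses e s(α, β)) ∧ L.Pairwise (CrossesBefore α β) ∧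
      ∀ e ∈ L, CrossesBefore α β s(c, d) e := by
  have h5 : ∀ e ∈ L, Crosses e s(α, β) ∧ d ∉ e := fun e he =>
    (hF.crosses_iff hD (h1 e he)).1 (h2 e he)
  refine ⟨fun e he => (h5 e he).1, ?_, fun e he => ?_⟩
  · exact h4.imp_of_mem fun {a b} ha hb hab => (hF.crossesBefore_iff (h1 a ha) (h1 b hb) (h5 a ha).1
      (h5 b hb).1 (h5 a ha).2 (h5 b hb).2).1 hab
  · refine hF.before e (h1 e he) (h5 e he).1 ?_
    rintro rfl
    exact (h5 _ he).2 (by simp)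

theorem IsFirst.isTPath_of_cons_cons_cons (hD : IsDissection D) (hF : IsFirst D α β c d)
    {r : List V} (h : IsTPath D α β (α :: c :: d :: r)) : IsTPath D d β (d :: r) := by
  have hm := h.monotone
  have h1 := h.even_mem
  have h2 := h.even_crosses
  have hnd := h.nodup
  have hdi := h.isDiagonal
  simp only [steps_cons_cons, evenTerms_cons_cons, List.pairwise_cons, List.mem_cons,
    forall_eq_or_imp, List.nodup_cons, not_or] at hm h1 h2 hnd hdi
  -- The first even step `{x, y}` of `d :: r` avoids `d`: `x = d` is degenerate and `y = d` repeats
  -- the step `{d, x}`. A later even step through `d` would force `d` onto `{x, y}` by monotonicity.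
  have h3 : ∀ e ∈ evenTerms (steps (d :: r)), d ∉ e := by
    rcases r with _ | ⟨x, _ | ⟨y, r⟩⟩
    · simp [steps, evenTerms, oddTerms]
    · simp [steps, evenTerms, oddTerms]
    · simp only [steps_cons_cons, evenTerms_cons_cons, List.pairwise_cons, List.mem_cons,
        forall_eq_or_imp, List.nodup_cons, not_or] at hm h1 h2 hnd hdi ⊢
      have hxy : d ∉ s(x, y) := by
        intro hd
        rcases Sym2.mem_iff.1 hd with rfl | rfl
        · exact hdi.2.2.1 (by simp)
        · exact hnd.2.2.1.1 Sym2.eq_swap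
      exact ⟨hxy, fun e he hd => hxy (hm.1.1.mem_of_mem (hm.2.1 e he) hd)⟩
  obtain ⟨h4, h5⟩ := hF.even_of_even hD h1.2 h2.2 h3 hm.2
  refine ⟨by simp, by simpa using h.last, hdi.2.2, hnd.2.2, fun e he => ?_, h1.2, h4, h5⟩
  exact h.noncrossing e (by simp [he])

theorem IsFirst.isTPath_of_cons_cons (hD : IsDissection D) (hF : IsFirst D α β c d)
    {x : V} {r : List V} (h : IsTPath D α β (α :: c :: x :: r)) (hx : x ≠ d) :
    IsTPath D d β (d :: c :: x :: r) := by
  obtain ⟨-, -, hbc, hbd, hcd⟩ := hF.ne hD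
  have hm := h.monotone
  have h1 := h.even_mem
  have h2 := h.even_crosses
  have hnd := h.nodup
  have hev : evenTerms (steps (d :: c :: x :: r)) = evenTerms (steps (α :: c :: x :: r)) := by simp
  -- Since `x ≠ d`, the first even step `{c, x}` comes strictly after `{c, d}` and avoids `d`; hence
  -- so do all later ones.
  have h3 : ∀ e ∈ evenTerms (steps (α :: c :: x :: r)), d ∉ e := by
    simp only [steps_cons_cons, evenTerms_cons_cons, List.pairwise_cons, List.mem_cons,
        forall_eq_or_imp] at hm h1 h2 ⊢
    have hxy : d ∉ s(c, x) := by
      intro hd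
      rcases Sym2.mem_iff.1 hd with rfl | rfl
      · exact hcd rfl
      · exact hx rfl
    have hb := hF.before _ h1.1 h2.1 (by rintro h; rw [h] at hxy; simp at hxy)
    exact ⟨hxy, fun e he hd => hxy (hb.mem_of_mem (hm.1 e he) hd)⟩
  obtain ⟨h4, h5⟩ := hF.even_of_even hD h1 h2 h3 hm
  have hnm := h.not_mem_tail (Ne.symm hbd) h3
  refine ⟨by simp, by simpa using h.last, ?_, ?_, ?_, hev ▸ h1, hev ▸ h4, hev ▸ h5⟩
  · have := h.isDiagonal
    rw [steps_cons_cons] at this ⊢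
    refine List.forall_mem_cons.2 ⟨fun h => hcd ?_, (List.forall_mem_cons.1 this).2⟩
    simpa using h.symm
  · rw [steps_cons_cons] at hnd ⊢
    exact List.nodup_cons.2 ⟨fun h => hnm (mem_of_mem_steps h (by simp)),
      (List.nodup_cons.1 hnd).2⟩
  · have := h.noncrossing
    rw [steps_cons_cons] at this ⊢
    refine List.forall_mem_cons.2 ⟨fun e he => ?_, (List.forall_mem_cons.1 this).2⟩
    rw [Sym2.eq_swap]
    exact hD.noncrossing _ hF.mem e he

/-- Every vertex of `τ` other than `β` lies on an even step, and even steps cross both `{d, β}` and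
`{α, β}`. This shows that new initial steps are not repeated. -/
theorem IsFirst.not_mem_of_isTPath (hD : IsDissection D) (hF : IsFirst D α β c d)
    {τ : List V} (h : IsTPath D d β (d :: τ)) : α ∉ τ ∧ d ∉ τ := by
  obtain ⟨-, -, hbc, hbd, hcd⟩ := hF.ne hD
  constructor
  · exact h.not_mem_tail hF.crosses.ne fun e he =>
      ((hF.crosses_iff hD (h.even_mem e he)).1 (h.even_crosses e he)).1.not_mem.1
  · exact h.not_mem_tail hbd.symm fun e he => (h.even_crosses e he).not_mem.1

theorem IsFirst.isTPath_cons_cons_cons (hD : IsDissection D) (hF : IsFirst D α β c d)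
    {r : List V} (h : IsTPath D d β (d :: r)) (hr : r.head? ≠ some c) :
    IsTPath D α β (α :: c :: d :: r) := by
  obtain ⟨hac, had, hbc, hbd, hcd⟩ := hF.ne hD
  obtain ⟨hα, hd⟩ := hF.not_mem_of_isTPath hD h
  obtain ⟨h4, h5, h6⟩ := hF.even_of_even' hD h.even_mem h.even_crosses h.monotone
  refine ⟨by simp, by simpa using h.last, ?_, ?_, ?_, ?_, ?_, ?_⟩ <;>
    simp only [steps_cons_cons, evenTerms_cons_cons, List.pairwise_cons, List.mem_cons,
      forall_eq_or_imp, List.nodup_cons, not_or]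
  · exact ⟨by simpa using hac, by simpa using hcd, h.isDiagonal⟩
  · refine ⟨⟨?_, fun hm => ?_⟩, fun hm => ?_, h.nodup⟩
    · simp only [Sym2.eq_iff]; tauto
    · have := mem_of_mem_steps hm (v := α) (by simp)
      simp_all
    -- The step `{c, d}` could only recur as the first step out of `d`, which `hr` excludes.
    · rcases r with _ | ⟨x, r⟩
      · simp [steps] at hm
      · simp only [steps_cons_cons, List.mem_cons] at hm
        rcases hm with hm | hm
        · rcases Sym2.eq_iff.1 hm with ⟨h, -⟩ | ⟨rfl, -⟩
          · exact hcd h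
          · simp at hr
        · exact hd (mem_of_mem_steps hm (by simp))
  · exact ⟨fun e he hc => hF.not_crosses hD he (crosses_comm.1 hc), hD.noncrossing _ hF.mem,
      h.noncrossing⟩
  · exact ⟨hF.mem, h.even_mem⟩
  · exact ⟨hF.crosses, h4⟩
  · exact ⟨h6, h5⟩

theorem IsFirst.isTPath_cons_cons (hD : IsDissection D) (hF : IsFirst D α β c d)
    {x : V} {r : List V} (h : IsTPath D d β (d :: c :: x :: r)) :
    IsTPath D α β (α :: c :: x :: r) ∧ x ≠ d := by
  obtain ⟨hac, had, hbc, hbd, hcd⟩ := hF.ne hD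
  obtain ⟨hα, hd⟩ := hF.not_mem_of_isTPath hD h
  obtain ⟨h4, h5, h6⟩ := hF.even_of_even' hD h.even_mem h.even_crosses h.monotone
  have hev : evenTerms (steps (α :: c :: x :: r)) = evenTerms (steps (d :: c :: x :: r)) := by simp
  refine ⟨⟨by simp, by simpa using h.last, ?_, ?_, ?_, hev ▸ h.even_mem, hev ▸ h4, hev ▸ h5⟩, ?_⟩
  · have := h.isDiagonal
    rw [steps_cons_cons] at this ⊢
    exact List.forall_mem_cons.2 ⟨by simpa using hac, (List.forall_mem_cons.1 this).2⟩
  · have hnd := h.nodup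
    rw [steps_cons_cons] at hnd ⊢
    exact List.nodup_cons.2 ⟨fun h => hα (mem_of_mem_steps h (by simp)),
      (List.nodup_cons.1 hnd).2⟩
  · have := h.noncrossing
    rw [steps_cons_cons] at this ⊢
    exact List.forall_mem_cons.2 ⟨fun e he hc => hF.not_crosses hD he (crosses_comm.1 hc),
      (List.forall_mem_cons.1 this).2⟩
  · rintro rfl
    simp at hd

theorem tPaths_eq_singleton (hne : α ≠ β) (h : ∀ e ∈ D, ¬ Crosses e s(α, β)) :
    tPaths D α β = {[α, β]} := by
  ext π
  rw [mem_tPaths, Finset.mem_singleton]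
  constructor
  · intro hπ
    obtain ⟨τ, rfl⟩ := hπ.exists_eq_cons
    rcases τ with _ | ⟨v, _ | ⟨x, r⟩⟩
    · exact absurd (by simpa using hπ.last) hne
    · have := hπ.last
      simp_all
    · exact absurd (hπ.even_crosses s(v, x) (by simp)) (h _ (hπ.even_mem _ (by simp)))
  · rintro rfl
    refine ⟨by simp, by simp, ?_, ?_, ?_, ?_, ?_, ?_⟩ <;>
      simp [steps, evenTerms, oddTerms, hne]
    exact fun e he hc => h e he (crosses_comm.1 hc)

end TPaths

/-! ### Path values and the recursion for the path sum. -/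

section Values

variable {V K : Type*} [CommGroup K] {f : Diagonal V → K}

theorem pathValue_cons_cons (a b : V) (l : List V) :
    pathValue f (a :: b :: l) = value f s(a, b) / pathValue f (b :: l) := by
  simp only [pathValue, steps_cons_cons, oddTerms_cons, evenTerms_cons, List.map_cons,
    List.prod_cons]
  rw [div_div_eq_mul_div]

theorem coe_mul_sum [AddCommSemigroup K] [LeftDistribClass K] {ι : Type*} (s : Finset ι) (k : K)
    (g : ι → K) :
    (k : WithZero K) * ∑ i ∈ s, (g i : WithZero K) = ∑ i ∈ s, ((k * g i : K) : WithZero K) := by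
  classical
  induction s using Finset.induction_on with
  | empty => simp
  | insert a s ha ih => rw [Finset.sum_insert ha, Finset.sum_insert ha, mul_add, ih,
      WithZero.coe_mul]

open Classical in
/-- `(π₁, π₂, …) ↦ (α, c, π₁, π₂, …)`, where the step from `c` to `π₁` and back is left out. -/
noncomputable def prependPath (α c : V) (π : List V) : List V :=
  if π.tail.head? = some c then α :: π.tail else α :: c :: π

theorem prependPath_of_eq (α c d : V) {r : List V} (h : r.head? = some c) :
    prependPath α c (d :: r) = α :: r := if_pos h

theorem prependPath_of_ne (α c d : V) {r : List V} (h : r.head? ≠ some c) :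
    prependPath α c (d :: r) = α :: c :: d :: r := if_neg h

variable [CircularOrder V] [Finite V] [AddCommSemigroup K] {D : Set (Sym2 V)} {α β c d : V}

/-- The Ptolemy relation for `{α, β}` and the first diagonal in `D` that it meets. -/
def FirstPtolemy (D : Set (Sym2 V)) (f : Diagonal V → K) : Prop :=
  ∀ α β c d, IsFirst D α β c d → value f s(α, β) * value f s(c, d) =
    value f s(α, c) * value f s(d, β) + value f s(α, d) * value f s(c, β)

theorem IsWeakFrieze.firstPtolemy (h : IsWeakFrieze D f) : FirstPtolemy D f := by
  intro α β c d hF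
  rw [h α β c d (crosses_comm.1 hF.crosses) hF.mem, Sym2.eq_swap (a := β) (b := d),
    Sym2.eq_swap (a := β) (b := c)]

variable [LeftDistribClass K]

open Classical in
/-- The `T`-paths whose second vertex is `c` come from those that start in `d`. -/
theorem IsFirst.sum_filter (hD : IsDissection D) (hF : IsFirst D α β c d) :
    ∑ π ∈ tPaths D α β with π[1]? = some c, ((pathValue f π : K) : WithZero K) =
      ((value f s(α, c) / value f s(c, d) : K) : WithZero K) *
        ∑ π ∈ tPaths D d β, ((pathValue f π : K) : WithZero K) := by
  obtain ⟨hac, had, hbc, hbd, hcd⟩ := hF.ne hD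
  rw [coe_mul_sum]
  symm
  refine Finset.sum_bij (fun π _ => prependPath α c π) ?_ ?_ ?_ ?_
  · intro π hπ
    rw [mem_tPaths] at hπ
    obtain ⟨r, rfl⟩ := hπ.exists_eq_cons
    rw [Finset.mem_filter, mem_tPaths]
    by_cases h : r.head? = some c
    · rw [prependPath_of_eq α c d h]
      rcases r with _ | ⟨v, _ | ⟨x, r⟩⟩
      · simp at h
      · have := hπ.last
        simp_all
      · obtain rfl : v = c := by simpa using h
        exact ⟨(hF.isTPath_cons_cons hD hπ).1, by simp⟩
    · rw [prependPath_of_ne α c d h]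
      exact ⟨hF.isTPath_cons_cons_cons hD hπ h, by simp⟩
  · intro π hπ π' hπ' heq
    rw [mem_tPaths] at hπ hπ'
    obtain ⟨r, rfl⟩ := hπ.exists_eq_cons
    obtain ⟨r', rfl⟩ := hπ'.exists_eq_cons
    have h1 := (hF.not_mem_of_isTPath hD hπ).2
    have h2 := (hF.not_mem_of_isTPath hD hπ').2
    -- In the two mixed cases, equal images would make `d` reappear in the tail of a `T`-path
    -- starting at `d`.
    by_cases h : r.head? = some c <;> by_cases h' : r'.head? = some c
    · rw [prependPath_of_eq α c d h, prependPath_of_eq α c d h'] at heq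
      simpa using heq
    · rw [prependPath_of_eq α c d h, prependPath_of_ne α c d h'] at heq
      obtain rfl : r = c :: d :: r' := by simpa using heq
      simp at h1
    · rw [prependPath_of_ne α c d h, prependPath_of_eq α c d h'] at heq
      obtain rfl : r' = c :: d :: r := by simpa using heq.symm
      simp at h2
    · rw [prependPath_of_ne α c d h, prependPath_of_ne α c d h'] at heq
      simpa using heq
  · intro π hπ
    rw [Finset.mem_filter, mem_tPaths] at hπ
    obtain ⟨hπ, h1⟩ := hπ
    obtain ⟨x, r, rfl⟩ : ∃ x r, π = α :: c :: x :: r := by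
      rcases hπ.exists_eq hF with h | ⟨x, r, rfl⟩
      · exact h
      · exact absurd (by simpa using h1) hcd.symm
    -- If the second step is `{c, d}`, the preimage drops `α, c`; otherwise it replaces `α` by `d`.
    by_cases hx : x = d
    · subst hx
      have h := hF.isTPath_of_cons_cons_cons hD hπ
      refine ⟨_, mem_tPaths.2 h, prependPath_of_ne _ _ _ fun hh => ?_⟩
      rcases r with _ | ⟨y, r⟩
      · simp at hh
      -- A return to `c` would use the step `{c, d}` twice.
      · obtain rfl : y = c := by simpa using hh
        have := hπ.nodup
        simp [Sym2.eq_swap (a := y) (b := x)] at this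
    · exact ⟨_, mem_tPaths.2 (hF.isTPath_of_cons_cons hD hπ hx), prependPath_of_eq _ _ _ rfl⟩
  · intro π hπ
    rw [mem_tPaths] at hπ
    obtain ⟨r, rfl⟩ := hπ.exists_eq_cons
    by_cases h : r.head? = some c
    · rw [prependPath_of_eq α c d h]
      rcases r with _ | ⟨v, r⟩
      · simp at h
      · obtain rfl : v = c := by simpa using h
        -- Here the path from `d` has odd first step `{d, c}`, whose value cancels the denominator
        -- `f(c, d)`.
        rw [pathValue_cons_cons, pathValue_cons_cons, Sym2.eq_swap (a := d) (b := v),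
          div_mul_div_cancel]
    · rw [prependPath_of_ne α c d h, pathValue_cons_cons, pathValue_cons_cons,
        div_div_eq_mul_div, div_mul_eq_mul_div]

theorem IsFirst.sum_pathValue (hD : IsDissection D) (hF : IsFirst D α β c d) :
    ∑ π ∈ tPaths D α β, ((pathValue f π : K) : WithZero K) =
      ((value f s(α, c) / value f s(c, d) : K) : WithZero K) *
        ∑ π ∈ tPaths D d β, ((pathValue f π : K) : WithZero K) +
      ((value f s(α, d) / value f s(c, d) : K) : WithZero K) *
        ∑ π ∈ tPaths D c β, ((pathValue f π : K) : WithZero K) := by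
  classical
  rw [← hF.sum_filter hD, Sym2.eq_swap (a := c) (b := d), ← hF.symm.sum_filter hD,
    ← Finset.sum_filter_add_sum_filter_not _ (fun π => π[1]? = some c)]
  congr 2
  refine Finset.filter_congr fun π hπ => ?_
  rcases (mem_tPaths.1 hπ).exists_eq hF with ⟨x, r, rfl⟩ | ⟨x, r, rfl⟩
  · simpa using (hF.ne hD).2.2.2.2
  · simpa using (hF.ne hD).2.2.2.2.symm

/-! ### Passing between the first-diagonal Ptolemy relation and the two properties. -/

theorem add_mul_of_left (a b c : K) : (a + b) * c = a * c + b * c := by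
  rw [mul_comm, mul_add, mul_comm c, mul_comm c]

theorem mul_eq_add_iff {x k a b a' b' : K} : x * k = a * b + a' * b' ↔
    x = a / k * b + a' / k * b' := by
  rw [← eq_div_iff_mul_eq', div_eq_mul_inv, add_mul_of_left, div_eq_mul_inv, div_eq_mul_inv]
  simp only [mul_right_comm]

theorem SatisfiesTPathFormula.firstPtolemy (hD : IsDissection D)
    (h : SatisfiesTPathFormula D f) : FirstPtolemy D f := by
  intro α β c d hF
  obtain ⟨hac, had, hbc, hbd, hcd⟩ := hF.ne hD
  have := hF.sum_pathValue hD (f := f)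
  rw [← h α β hF.crosses.ne, ← h d β hbd.symm, ← h c β hbc.symm] at this
  exact mul_eq_add_iff.2 (by exact_mod_cast this)

/-- The number of diagonals in `D` that cross `{α, β}`. -/
noncomputable def crossingNumber (D : Set (Sym2 V)) (α β : V) : ℕ :=
  {e ∈ D | Crosses e s(α, β)}.ncard

/-- The inclusion of crossing sets is strict because `{c, d}` crosses `{α, β}` but shares `d` with
`{d, β}`. -/
theorem IsFirst.crossingNumber_lt (hD : IsDissection D) (hF : IsFirst D α β c d) :
    crossingNumber D d β < crossingNumber D α β := by
  refine Set.ncard_lt_ncard ⟨fun e he => ⟨he.1, ((hF.crosses_iff hD he.1).1 he.2).1⟩, fun h => ?_⟩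
    (Set.toFinite _)
  exact (h ⟨hF.mem, hF.crosses⟩).2.not_mem.1 (by simp)

theorem FirstPtolemy.satisfiesTPathFormula (hD : IsDissection D) (h : FirstPtolemy D f) :
    SatisfiesTPathFormula D f := by
  suffices ∀ n α β, α ≠ β → crossingNumber D α β < n → ((value f s(α, β) : K) : WithZero K) =
      ∑ π ∈ tPaths D α β, ((pathValue f π : K) : WithZero K) from
    fun α β hne => this _ α β hne (Nat.lt_succ_self _)
  intro n
  induction n with
  | zero => intro α β _ h; omega
  | succ n ih =>
    intro α β hne hn
    by_cases hE : ∃ e ∈ D, Crosses e s(α, β)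
    · obtain ⟨e, he, hc⟩ := hE
      obtain ⟨c, d, hF⟩ := exists_isFirst hD he hc
      obtain ⟨hac, had, hbc, hbd, hcd⟩ := hF.ne hD
      have h1 := hF.crossingNumber_lt hD
      have h2 := hF.symm.crossingNumber_lt hD
      rw [hF.sum_pathValue hD, ← ih d β hbd.symm (by omega), ← ih c β hbc.symm (by omega)]
      exact_mod_cast mul_eq_add_iff.1 (h α β c d hF)
    · push Not at hE
      rw [tPaths_eq_singleton hne hE, Finset.sum_singleton, pathValue_cons_cons]
      simp [pathValue, steps, oddTerms, evenTerms]

/-- The algebra of the induction step for the Ptolemy relation. -/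
theorem ptolemy_step {x cd g ac db ad cb gβ δβ aγ aδ dγ dδ cγ cδ : K}
    (h : x * cd = ac * db + ad * cb) (hd : db * g = dγ * δβ + dδ * gβ)
    (hc : cb * g = cγ * δβ + cδ * gβ) (hγ : aγ * cd = ac * dγ + ad * cγ)
    (hδ : aδ * cd = ac * dδ + ad * cδ) : x * g = aγ * δβ + aδ * gβ := by
  apply mul_right_cancel (b := cd)
  calc x * g * cd = ac * (db * g) + ad * (cb * g) := by
        rw [mul_right_comm, h, add_mul_of_left, mul_assoc, mul_assoc]
    _ = (ac * dγ + ad * cγ) * δβ + (ac * dδ + ad * cδ) * gβ := by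
        rw [hd, hc]
        simp only [mul_add, add_mul_of_left, mul_assoc]
        ac_rfl
    _ = _ := by rw [← hγ, ← hδ, add_mul_of_left]; ac_rfl

/-- The induction step if the two diagonals share the vertex `c`. -/
theorem ptolemy_step_of_common {x cd g ac db ad cb δβ aδ dδ : K}
    (h : x * cd = ac * db + ad * cb) (hd : db * g = cd * δβ + dδ * cb)
    (hδ : aδ * cd = ac * dδ + ad * g) : x * g = ac * δβ + aδ * cb := by
  apply mul_right_cancel (b := cd)
  calc x * g * cd = ac * (db * g) + ad * g * cb := by
        rw [mul_right_comm, h, add_mul_of_left]; ac_rfl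
    _ = ac * δβ * cd + (ac * dδ + ad * g) * cb := by
        rw [hd, mul_add, add_mul_of_left, add_assoc, mul_comm cd, ← mul_assoc,
          ← mul_assoc]
    _ = _ := by rw [← hδ, add_mul_of_left, mul_right_comm aδ]

/-- Induction on the crossing number of `{α, β}`. When `{γ, δ}` differs from the first diagonal `{c,
d}`, the induction hypothesis handles `{d, β}` and `{c, β}`, while `{c, d}` is still the first
diagonal met by `{α, γ}` and `{α, δ}`, as long as no vertex is shared. -/
theorem FirstPtolemy.isWeakFrieze (hD : IsDissection D) (h : FirstPtolemy D f) :
    IsWeakFrieze D f := by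
  suffices ∀ n α β γ δ, Crosses s(γ, δ) s(α, β) → s(γ, δ) ∈ D → crossingNumber D α β < n →
      value f s(α, β) * value f s(γ, δ) =
        value f s(α, γ) * value f s(δ, β) + value f s(α, δ) * value f s(γ, β) by
    intro α β γ δ hc hm
    rw [this _ α β γ δ (crosses_comm.1 hc) hm (Nat.lt_succ_self _), Sym2.eq_swap (a := β) (b := δ),
      Sym2.eq_swap (a := β) (b := γ)]
  intro n
  induction n with
  | zero => intro α β γ δ _ _ h; omega
  | succ n ih =>
    intro α β γ δ hc hm hn
    obtain ⟨c, d, hF⟩ := exists_isFirst hD hm hc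
    by_cases heq : s(γ, δ) = s(c, d)
    · rw [heq] at hm hc
      rcases Sym2.eq_iff.1 heq with ⟨rfl, rfl⟩ | ⟨rfl, rfl⟩
      · exact h _ _ _ _ hF
      · exact h _ _ _ _ hF.symm
    have hγ : γ ≠ c → γ ≠ d → IsFirst D α γ c d := hF.of_mem hD hm hc (by simp)
    have hδ : δ ≠ c → δ ≠ d → IsFirst D α δ c d := hF.of_mem hD hm hc (by simp)
    -- If `γ = c`, then `{γ, δ}` does not cross `{c, β}` and `{c, d}` does not cross `{α, γ}`, so
    -- only three of the five relations remain. The quantifiers allow reuse for the other three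
    -- coincidences by symmetry.
    have common : ∀ c d γ δ, IsFirst D α β c d → s(γ, δ) ∈ D → Crosses s(γ, δ) s(α, β) →
        s(γ, δ) ≠ s(c, d) → γ = c → value f s(α, β) * value f s(γ, δ) =
        value f s(α, γ) * value f s(δ, β) + value f s(α, δ) * value f s(γ, β) := by
      rintro c d γ δ hF hm hc hne rfl
      obtain ⟨-, -, -, -, hcd⟩ := hF.ne hD
      have hγδ : γ ≠ δ := by simpa using (hD.internal _ hm).1
      have hdδ : d ≠ δ := fun h => hne (by rw [h])
      have h1 := h _ _ _ _ hF
      have h2 := ih d β γ δ ((hF.crosses_iff hD hm).2 ⟨hc, by simp [hcd.symm, hdδ]⟩) hm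
        (by have := hF.crossingNumber_lt hD; omega)
      have h3 := h _ _ _ _ (hF.of_mem hD hm hc (γ := δ) (by simp) hγδ.symm hdδ.symm)
      rw [Sym2.eq_swap (a := d) (b := γ)] at h2
      exact ptolemy_step_of_common h1 h2 h3
    have swap : ∀ x y : V, s(x, y) = s(y, x) := fun x y => Sym2.eq_swap
    by_cases h1 : γ = c
    · exact common c d γ δ hF hm hc heq h1
    by_cases h2 : γ = d
    · exact common d c γ δ hF.symm hm hc (by rwa [swap d c]) h2
    by_cases h3 : δ = c
    · rw [swap γ δ, add_comm]
      exact common c d δ γ hF (by rwa [swap]) (by rwa [swap δ]) (by rwa [swap δ]) h3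
    by_cases h4 : δ = d
    · rw [swap γ δ, add_comm]
      exact common d c δ γ hF.symm (by rwa [swap]) (by rwa [swap δ]) (by rwa [swap δ, swap d]) h4
    have hd' := hF.crossingNumber_lt hD
    have hc' := hF.symm.crossingNumber_lt hD
    refine ptolemy_step (h _ _ _ _ hF) (ih d β γ δ ?_ hm (by omega)) (ih c β γ δ ?_ hm (by omega))
      (h _ _ _ _ (hγ h1 h2)) (h _ _ _ _ (hδ h3 h4))
    · exact (hF.crosses_iff hD hm).2 ⟨hc, by simp [Ne.symm h2, Ne.symm h4]⟩
    · exact (hF.symm.crosses_iff hD hm).2 ⟨hc, by simp [Ne.symm h1, Ne.symm h3]⟩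

end Values
end WeakFrieze

theorem theoremA {V : Type*} [Fintype V] [CircularOrder V] (hV : 3 ≤ Fintype.card V)
    {K : Type*} [CommGroup K] [AddCommSemigroup K] [LeftDistribClass K]
    (D : Set (Sym2 V)) (hD : WeakFrieze.IsDissection D) (f : WeakFrieze.Diagonal V → K) :
    WeakFrieze.IsWeakFrieze D f ↔ WeakFrieze.SatisfiesTPathFormula D f :=
  ⟨fun h => h.firstPtolemy.satisfiesTPathFormula hD, fun h => (h.firstPtolemy hD).isWeakFrieze hD⟩
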